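/- Let $d,K\ge 1$, $p=d+1$, let $T_1,\dots,T_d\ge 2$ and $T_p=N$ be integers, and let $\sigma>0$. For a parameter $\theta=(x_{i,k})_{1\le i\le p,\,1\le k\le K}$ with $x_{i,k}\in\mathbb{C}^{T_i}$ one observes $$y=\sum_{k=1}^{K}x_{1,k}\otimes\cdots\otimes x_{p,k}+w,$$ where $w$ has i.i.d. circularly symmetric complex Gaussian entries of variance $\sigma^2$; $\mathbb{E}_\theta$ denotes expectation under this law. Fix a true parameter $\theta$ with $\|x_{i,k}\|^2=T_i$ for all $i\le d$ and all $k$, and let $$\Theta_\theta=\{\theta'=(x'_{i,k}):\ \|x'_{i,k}\|^2=T_i,\ \operatorname{Im}(x_{i,k}^Hx'_{i,k})=0\ \text{ for all } i\le d,\ k\}.$$ Let $\hat\theta=(\hat z_{i,k})$ be an estimator (a measurable function of $y$) satisfying these constraints, i.e. $\hat\theta\in\Theta_\theta$ almost surely: $\|\hat z_{i,k}\|^2=T_i$ and $\operatorname{Im}(x_{i,k}^H\hat z_{i,k})=0$ for all $i\le d$ and all $k$. (a) Suppose that $\mathbb{E}_\theta[\hat z_{i,k}]=\alpha_{i,k}x_{i,k}$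 with $\alpha_{i,k}\in[0,1]$ for all $i\le d$ and all $k$. Then for all $i\le d$ and $k$ with $\alpha_{i,k}\neq 0$, $$\alpha_{i,k}^2=\frac{1}{1+\xi_{i,k}},\qquad\text{where}\quad \xi_{i,k}=\frac{\mathbb{E}_\theta\big[\|\hat z_{i,k}-\alpha_{i,k}x_{i,k}\|^2\big]}{T_i\,\alpha_{i,k}^2}.$$ (b) Suppose that the scalar-bias assumption holds locally at $\theta$ in the constrained parameter set: there are real numbers $\alpha_{i,k}(\theta')$ such that for all $i\le d$ and all $k$, $\alpha_{i,k}(\theta)\in[0,1]$, $\mathbb{E}_{\theta}[\hat z_{i,k}]=\alpha_{i,k}(\theta)\,x_{i,k}$, and $$\mathbb{E}_{\theta'}[\hat z_{i,k}]=\alpha_{i,k}(\theta')\,x'_{i,k}+o(\|\theta'-\theta\|)\quad\text{as }\theta'\to\theta,\ \theta'\in\Theta_\theta$$ (in particular, this holds if $\mathbb{E}_{\theta'}[\hat z_{i,k}]=\alpha_{i,k}(\theta')x'_{i,k}$ for all $\theta'\in\Theta_\theta$ near $\theta$). Let $i\le d$, let $s_{-i,k}=\bigotimes_{j\neq i}x_{j,k}$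 (the product over all modes $j\le p$, $j\ne i$), $S_{-i}=(s_{-i,1},\dots,s_{-i,K})$, assume that $\Gamma_i=S_{-i}^HS_{-i}$ is invertible, and let $0<\eta_i^-\le\eta_i^+$ be such that $$\eta_i^-\,\mathrm{diag}\big((\Gamma_i^{-1})_{kk}\big)_{k}\preceq\Gamma_i^{-1}\preceq\eta_i^+\,\mathrm{diag}\big((\Gamma_i^{-1})_{kk}\big)_{k}.$$ Let $P^\perp_{S_{-i,-k}}$ be the orthogonal projection onto the orthogonal complement of the span of the $s_{-i,k'}$, $k'\neq k$, and $$\xi^*_{i,k}=\frac{\sigma^2(T_i-1)}{T_i\,\|P^\perp_{S_{-i,-k}}s_{-i,k}\|^2}\left(1-\frac{(\eta_i^+)^2-1}{(T_i-1)\,\eta_i^-}\right).$$ Then for every $k$ with $1+\xi^*_{i,k}>0$, $$\frac{1}{T_i}\,\mathbb{E}_\theta\big[\|\hat z_{i,k}-x_{i,k}\|^2\big]\ \ge\ 2\left(1-\frac{1}{(1+\xi^*_{i,k})^{1/2}}\right).$$ -/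

import Mathlib

open MeasureTheory ProbabilityTheory Filter Topology Asymptotics
open scoped ComplexOrder

noncomputable section

namespace TensorMod

/-- Parameters `θ = (x_{i,k})` of a tensor model with `d + 1` modes and `K` users: `θ i k ∈ ℂ^{T i}`.
The modes `i < d` carry information; the last mode is the channel, `θ (Fin.last d) k = h_k ∈ ℂ^N`
with `N = T (Fin.last d)`. -/
abbrev Param {d : ℕ} (T : Fin (d + 1) → ℕ) (K : ℕ) : Type :=
  ∀ i : Fin (d + 1), Fin K → EuclideanSpace ℂ (Fin (T i))

/-- The received signal `y`, an element of `ℂ^{T_1} ⊗ ⋯ ⊗ ℂ^{T_d} ⊗ ℂ^N` in coordinates. -/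
abbrev Obs {d : ℕ} (T : Fin (d + 1) → ℕ) : Type := (∀ i : Fin (d + 1), Fin (T i)) → ℂ

variable {d : ℕ} {T : Fin (d + 1) → ℕ} {K : ℕ}

/-- The noise-free signal `∑_k x_{1,k} ⊗ ⋯ ⊗ x_{d,k} ⊗ h_k`. -/
def signal (θ : Param T K) : Obs T := fun n => ∑ k, ∏ i, θ i k (n i)

/-- The circularly symmetric complex Gaussian law `CN(m, v)`: independent real and imaginary parts
of variance `v / 2` each. -/
def complexGaussian (m : ℂ) (v : ℝ) : Measure ℂ :=
  ((gaussianReal m.re (v / 2).toNNReal).prod (gaussianReal m.im (v / 2).toNNReal)).map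
    Complex.measurableEquivRealProd.symm

/-- The law of `y = signal θ + w`, where `w` has i.i.d. `CN(0, σ²)` entries. -/
def law (σ : ℝ) (θ : Param T K) : Measure (Obs T) :=
  Measure.pi fun n => complexGaussian (signal θ n) (σ ^ 2)

/-- The set of parameters obeying the norm constraints `‖x'_{i,k}‖² = T_i` and the phase constraints
`Im (x_{i,k}ᴴ x'_{i,k}) = 0` (for `i ≤ d`), the phase reference being the parameter `θ`. -/
def constraintSet (θ : Param T K) : Set (Param T K) :=
  {θ' | ∀ (i : Fin d) (k : Fin K), ‖θ' i.castSucc k‖ ^ 2 = (T i.castSucc : ℝ) ∧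
    (inner ℂ (θ i.castSucc k) (θ' i.castSucc k)).im = 0}

/-- An estimator (a measurable function of `y`) satisfies the constraints at the true parameter `θ`
if it takes its values in the constraint set almost surely. -/
def SatisfiesConstraints (σ : ℝ) (θ : Param T K) (est : Obs T → Param T K) : Prop :=
  ∀ᵐ y ∂(law σ θ), est y ∈ constraintSet θ

/-- `E_θ[ẑ_{i,k}]`. -/
def mean (σ : ℝ) (θ : Param T K) (est : Obs T → Param T K) (i : Fin d) (k : Fin K) :
    EuclideanSpace ℂ (Fin (T i.castSucc)) :=
  ∫ y, est y i.castSucc k ∂(law σ θ)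

/-- `E_θ[ẑ_{i,k}] = α_{i,k} x_{i,k}` with `α_{i,k} ∈ [0, 1]`, at the parameter `θ`. -/
def HasScalarBias (σ : ℝ) (θ : Param T K) (est : Obs T → Param T K) (α : Fin d → Fin K → ℝ) :
    Prop :=
  ∀ i k, α i k ∈ Set.Icc (0 : ℝ) 1 ∧ mean σ θ est i k = (α i k : ℂ) • θ i.castSucc k

/-- The scalar-bias assumption as an assumption on the bias function near the true parameter `θ`:
it holds at `θ`, and for parameters `θ'` of the constraint set,
`E_θ'[ẑ_{i,k}] = α_{i,k}(θ') x'_{i,k} + o(‖θ' - θ‖)` as `θ' → θ`. The remainder is `0` when the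
scalar-bias identity holds exactly for all `θ'` near `θ`. -/
structure HasScalarBiasNear (σ : ℝ) (θ : Param T K) (est : Obs T → Param T K)
    (α : Param T K → Fin d → Fin K → ℝ) : Prop where
  bias_self : HasScalarBias σ θ est (α θ)
  bias_near : ∀ i k,
    (fun θ' : Param T K => mean σ θ' est i k - (α θ' i k : ℂ) • θ' i.castSucc k)
      =o[𝓝[constraintSet θ] θ] (fun θ' : Param T K => θ' - θ)

/-- The normalized variance `ξ_{i,k} = E_θ[‖ẑ_{i,k} - α_{i,k} x_{i,k}‖²] / (T_i α_{i,k}²)`. -/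
def normVar (σ : ℝ) (θ : Param T K) (est : Obs T → Param T K) (α : Fin d → Fin K → ℝ)
    (i : Fin d) (k : Fin K) : ℝ :=
  (∫ y, ‖est y i.castSucc k - (α i k : ℂ) • θ i.castSucc k‖ ^ 2 ∂(law σ θ)) /
    ((T i.castSucc : ℝ) * α i k ^ 2)

/-- The mean square error `E_θ[‖ẑ_{i,k} - x_{i,k}‖²] / T_i`. -/
def mse (σ : ℝ) (θ : Param T K) (est : Obs T → Param T K) (i : Fin d) (k : Fin K) : ℝ :=
  1 / (T i.castSucc : ℝ) * ∫ y, ‖est y i.castSucc k - θ i.castSucc k‖ ^ 2 ∂(law σ θ)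

/-- `s_{-i,k}`: the Kronecker product of the `x_{j,k}` over all modes `j ≠ i`, channel included. -/
def partialKron (θ : Param T K) (i : Fin (d + 1)) (k : Fin K) :
    EuclideanSpace ℂ (∀ j : {j : Fin (d + 1) // j ≠ i}, Fin (T j)) :=
  WithLp.toLp 2 fun n => ∏ j : {j : Fin (d + 1) // j ≠ i}, θ j k (n j)

/-- `S_{-i}`, the matrix with columns `s_{-i,1}, …, s_{-i,K}`. -/
def kronMatrix (θ : Param T K) (i : Fin (d + 1)) :
    Matrix (∀ j : {j : Fin (d + 1) // j ≠ i}, Fin (T j)) (Fin K) ℂ :=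
  Matrix.of fun n k => partialKron θ i k n

open scoped Matrix in
/-- `Γ_i = S_{-i}ᴴ S_{-i}`. -/
def Gam (θ : Param T K) (i : Fin (d + 1)) : Matrix (Fin K) (Fin K) ℂ :=
  (kronMatrix θ i)ᴴ * kronMatrix θ i

/-- The diagonal part of `Γ_i⁻¹`. -/
def diagInv (θ : Param T K) (i : Fin (d + 1)) : Matrix (Fin K) (Fin K) ℂ :=
  Matrix.diagonal fun k => (Gam θ i)⁻¹ k k

/-- `P^⊥ s_{-i,k}`: the projection of `s_{-i,k}` on the orthogonal complement of the span of the
other columns `s_{-i,k'}`, `k' ≠ k`, of `S_{-i}`. -/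
def residual (θ : Param T K) (i : Fin (d + 1)) (k : Fin K) :
    EuclideanSpace ℂ (∀ j : {j : Fin (d + 1) // j ≠ i}, Fin (T j)) :=
  (Submodule.span ℂ (partialKron θ i '' {k' | k' ≠ k}))ᗮ.starProjection (partialKron θ i k)

/-- `ξ*_{i,k}`, for given `η_i^- = ηm` and `η_i^+ = ηp`. -/
def xiStar (σ : ℝ) (θ : Param T K) (i : Fin (d + 1)) (k : Fin K) (ηm ηp : ℝ) : ℝ :=
  σ ^ 2 * ((T i : ℝ) - 1) / ((T i : ℝ) * ‖residual θ i k‖ ^ 2) *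
    (1 - (ηp ^ 2 - 1) / (((T i : ℝ) - 1) * ηm))

end TensorMod

end

/-! ### Likelihood ratios of shifted Gaussian product laws, and the bound they give. -/

open scoped ENNReal NNReal

/-! Almost surely `‖ẑ‖² = T = ‖x‖²`, so `E‖ẑ - βx‖² = T(1 - 2βα + β²)` for real `β`. Taking `β = α`
gives (a). Taking `β = 1` turns the mean square error into `2(1 - α)`, so (b) reduces to `α²(1 + ξ*)
≤ 1`.

That inequality is a Cramér–Rao bound. Fix `a ⟂ x_k` and move only mode `i`, along spheres, with
velocities `v_l ⟂ x_l`. The mean of `Re⟪a, ẑ_k⟫` then has derivative `α Re⟪a, v_k⟫`: the variation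
of `α` is invisible because `⟪a, x_k⟫ = 0`. Hence `(α Re⟪a, v_k⟫)² ≤ E[(Re⟪a, ẑ_k⟫)²] · 2 ∑
Γ_{lm}⟪v_l, v_m⟫ / σ²` (`sq_mul_re_inner_le`), a limit of Hammersley–Chapman–Robbins bounds.

The velocities come from `exists_direction`, with `A = Γ⁻¹`: Lagrange multipliers for `v_l ⟂ x_l`
solve a system with matrix `A ⊙ gram`, and the Schur product theorem bounds it below by `η⁻ diag A`.
Adding the bounds for `a` and `I • a`, then summing `a` over an orthonormal basis of `x_kᗮ`, gives
`T - 1` copies of `A_kk` minus a correction. Bessel and `A ⪯ η⁺ diag A` control the correction, and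
Bessel also bounds the other side by `T(1 - α²)`. Finally `A_kk` is the inverse squared norm of the
residual of `s_{-i,k}`. -/

theorem MeasureTheory.Measure.pi_withDensity_prod {ι : Type*} [Fintype ι] {X : ι → Type*}
    [∀ i, MeasurableSpace (X i)] (μ ν : ∀ i, Measure (X i)) [∀ i, IsProbabilityMeasure (μ i)]
    [∀ i, IsProbabilityMeasure (ν i)] (f : ∀ i, X i → ℝ≥0∞) (hf : ∀ i, Measurable (f i))
    (h : ∀ i, ν i = (μ i).withDensity (f i)) :
    Measure.pi ν = (Measure.pi μ).withDensity (fun y => ∏ i, f i (y i)) := by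
  refine Measure.pi_eq fun s hs => ?_
  rw [withDensity_apply _ (MeasurableSet.univ_pi hs),
    ← lintegral_indicator (MeasurableSet.univ_pi hs)]
  have h1 : (Set.univ.pi s).indicator (fun y : ∀ i, X i => ∏ i, f i (y i)) =
      fun y => ∏ i, (s i).indicator (f i) (y i) := by
    funext y
    by_cases hy : y ∈ Set.univ.pi s
    · rw [Set.indicator_of_mem hy]
      exact Finset.prod_congr rfl fun i _ => (Set.indicator_of_mem (hy i trivial) _).symm
    · rw [Set.indicator_of_notMem hy]
      simp only [Set.mem_pi, Set.mem_univ, true_implies, not_forall] at hy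
      obtain ⟨i, hi⟩ := hy
      exact (Finset.prod_eq_zero (Finset.mem_univ i) (Set.indicator_of_notMem hi _)).symm
  rw [h1]
  have hm : ∀ i, Measurable ((s i).indicator (f i)) := fun i => (hf i).indicator (hs i)
  -- Coordinates are independent under a product measure, so the integral of the product over a box
  -- factorises.
  have hind : iIndepFun (fun i (y : ∀ i, X i) => (s i).indicator (f i) (y i)) (Measure.pi μ) :=
    iIndepFun_pi fun i => (hm i).aemeasurable
  rw [lintegral_prod_eq_prod_lintegral_of_indepFun Finset.univ _ hind
    fun i => (hm i).comp (measurable_pi_apply i)]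
  refine Finset.prod_congr rfl fun i _ => ?_
  rw [h i, withDensity_apply _ (hs i), ← lintegral_indicator (hs i),
    (measurePreserving_eval μ i).lintegral_comp (hm i)]

theorem ProbabilityTheory.gaussianReal_add_eq_withDensity (μ δ : ℝ) {v : ℝ≥0} (hv : v ≠ 0) :
    gaussianReal (μ + δ) v = (gaussianReal μ v).withDensity
      (fun x => ENNReal.ofReal (Real.exp ((2 * (δ * (x - μ)) - δ ^ 2) / (2 * v)))) := by
  rw [gaussianReal_of_var_ne_zero _ hv, gaussianReal_of_var_ne_zero _ hv,
    ← withDensity_mul _ (measurable_gaussianPDF _ _) (by fun_prop)]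
  congr 1
  funext x
  have hv' : (v : ℝ) ≠ 0 := by exact_mod_cast hv
  simp only [gaussianPDF, Pi.mul_apply, gaussianPDFReal_def]
  rw [← ENNReal.ofReal_mul (by positivity), mul_assoc (√(2 * Real.pi * v))⁻¹, ← Real.exp_add]
  congr 3
  field_simp
  ring

namespace TensorMod

instance (m : ℂ) (v : ℝ) : IsProbabilityMeasure (complexGaussian m v) :=
  Measure.isProbabilityMeasure_map Complex.measurableEquivRealProd.symm.measurable.aemeasurable

/-- The density of `CN(m + δ, v)` with respect to `CN(m, v)`. -/
noncomputable def gaussianRatio (m δ : ℂ) (v : ℝ) (z : ℂ) : ℝ :=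
  Real.exp ((2 * (δ.re * (z.re - m.re) + δ.im * (z.im - m.im)) - ‖δ‖ ^ 2) / v)

@[fun_prop]
theorem measurable_gaussianRatio (m δ : ℂ) (v : ℝ) : Measurable (gaussianRatio m δ v) := by
  unfold gaussianRatio
  fun_prop

theorem gaussianRatio_pos (m δ : ℂ) (v : ℝ) (z : ℂ) : 0 < gaussianRatio m δ v z := Real.exp_pos _

theorem complexGaussian_add_eq_withDensity (m δ : ℂ) {v : ℝ} (hv : 0 < v) :
    complexGaussian (m + δ) v = (complexGaussian m v).withDensity
      (fun z => ENNReal.ofReal (gaussianRatio m δ v z)) := by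
  have hv2 : (v / 2).toNNReal ≠ 0 := by simpa using hv
  have hv3 : ((v / 2).toNNReal : ℝ) = v / 2 := Real.coe_toNNReal _ (by positivity)
  unfold complexGaussian
  rw [Complex.add_re, Complex.add_im, gaussianReal_add_eq_withDensity _ _ hv2,
    gaussianReal_add_eq_withDensity _ _ hv2, prod_withDensity (by fun_prop) (by fun_prop)]
  ext s hs
  rw [withDensity_apply _ hs, Measure.map_apply (by fun_prop) hs,
    withDensity_apply _ (Complex.measurableEquivRealProd.symm.measurable hs),
    setLIntegral_map hs (by fun_prop) (by fun_prop)]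
  refine lintegral_congr fun x => ?_
  rw [← ENNReal.ofReal_mul (by positivity), ← Real.exp_add, gaussianRatio, hv3,
    ← Complex.normSq_eq_norm_sq, Complex.normSq_apply]
  congr 2
  simp only [Complex.measurableEquivRealProd_symm_apply]
  field_simp
  ring

/-- Squaring the ratio doubles the shift up to a constant, so second moments of likelihood ratios
reduce to total mass one. -/
theorem gaussianRatio_sq (m δ : ℂ) (v : ℝ) (z : ℂ) :
    gaussianRatio m δ v z ^ 2 =
      Real.exp (2 * ‖δ‖ ^ 2 / v) * gaussianRatio m (2 * δ) v z := by
  simp only [gaussianRatio]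
  rw [← Real.exp_nat_mul, ← Real.exp_add]
  congr 1
  simp only [norm_mul, Complex.mul_re, Complex.mul_im, Complex.norm_ofNat, Complex.re_ofNat,
    Complex.im_ofNat]
  ring

section product

variable {ι : Type*} [Fintype ι] {v : ℝ}

/-- The density of a product of complex Gaussian laws with respect to another one. -/
noncomputable def piRatio (m δ : ι → ℂ) (v : ℝ) (y : ι → ℂ) : ℝ :=
  ∏ n, gaussianRatio (m n) (δ n) v (y n)

@[fun_prop]
theorem measurable_piRatio (m δ : ι → ℂ) (v : ℝ) : Measurable (piRatio m δ v) := by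
  unfold piRatio
  fun_prop

theorem piRatio_pos (m δ : ι → ℂ) (v : ℝ) (y : ι → ℂ) : 0 < piRatio m δ v y :=
  Finset.prod_pos fun _ _ => gaussianRatio_pos _ _ _ _

theorem pi_complexGaussian_add_eq_withDensity (m δ : ι → ℂ) (hv : 0 < v) :
    Measure.pi (fun n => complexGaussian (m n + δ n) v) =
      (Measure.pi fun n => complexGaussian (m n) v).withDensity
        (fun y => ENNReal.ofReal (piRatio m δ v y)) := by
  rw [Measure.pi_withDensity_prod (fun n => complexGaussian (m n) v) _ _ (fun n => by fun_prop)
    (fun n => complexGaussian_add_eq_withDensity (m n) (δ n) hv)]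
  congr 1
  funext y
  rw [piRatio, ENNReal.ofReal_prod_of_nonneg fun _ _ => (gaussianRatio_pos _ _ _ _).le]

theorem integral_pi_complexGaussian_add (m δ : ι → ℂ) (hv : 0 < v) (f : (ι → ℂ) → ℝ) :
    ∫ y, f y ∂(Measure.pi fun n => complexGaussian (m n + δ n) v) =
      ∫ y, piRatio m δ v y * f y ∂(Measure.pi fun n => complexGaussian (m n) v) := by
  rw [pi_complexGaussian_add_eq_withDensity m δ hv,
    integral_withDensity_eq_integral_toReal_smul (by fun_prop) (by simp)]
  simp [ENNReal.toReal_ofReal (piRatio_pos _ _ _ _).le]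

theorem integral_piRatio (m δ : ι → ℂ) (hv : 0 < v) :
    ∫ y, piRatio m δ v y ∂(Measure.pi fun n => complexGaussian (m n) v) = 1 := by
  have h := integral_pi_complexGaussian_add m δ hv (fun _ => 1)
  simpa using h.symm

theorem integrable_piRatio (m δ : ι → ℂ) (hv : 0 < v) :
    Integrable (piRatio m δ v) (Measure.pi fun n => complexGaussian (m n) v) :=
  -- A non-integrable function would have Bochner integral `0`, not `1`.
  .of_integral_ne_zero (by rw [integral_piRatio m δ hv]; exact one_ne_zero)

theorem piRatio_sq (m δ : ι → ℂ) (v : ℝ) (y : ι → ℂ) :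
    piRatio m δ v y ^ 2 =
      Real.exp (2 * (∑ n, ‖δ n‖ ^ 2) / v) * piRatio m (2 * δ) v y := by
  simp only [piRatio, ← Finset.prod_pow, gaussianRatio_sq, Finset.prod_mul_distrib,
    ← Real.exp_sum, Finset.mul_sum, Finset.sum_div]
  rfl

theorem integrable_piRatio_sq (m δ : ι → ℂ) (hv : 0 < v) :
    Integrable (fun y => piRatio m δ v y ^ 2) (Measure.pi fun n => complexGaussian (m n) v) := by
  simp only [piRatio_sq]
  exact (integrable_piRatio m _ hv).const_mul _

theorem integral_piRatio_sq (m δ : ι → ℂ) (hv : 0 < v) :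
    ∫ y, piRatio m δ v y ^ 2 ∂(Measure.pi fun n => complexGaussian (m n) v) =
      Real.exp (2 * (∑ n, ‖δ n‖ ^ 2) / v) := by
  simp only [piRatio_sq]
  rw [integral_const_mul, integral_piRatio m _ hv, mul_one]

/-- The Hammersley–Chapman–Robbins bound for a shift of the mean of a complex Gaussian vector. -/
theorem sq_integral_sub_integral_le (m δ : ι → ℂ) (hv : 0 < v) {f : (ι → ℂ) → ℝ}
    (hf : Measurable f) {C : ℝ}
    (hC : ∀ᵐ y ∂(Measure.pi fun n => complexGaussian (m n) v), |f y| ≤ C) :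
    ((∫ y, f y ∂(Measure.pi fun n => complexGaussian (m n + δ n) v)) -
        ∫ y, f y ∂(Measure.pi fun n => complexGaussian (m n) v)) ^ 2 ≤
      (∫ y, f y ^ 2 ∂(Measure.pi fun n => complexGaussian (m n) v)) *
        (Real.exp (2 * (∑ n, ‖δ n‖ ^ 2) / v) - 1) := by
  set P := Measure.pi fun n => complexGaussian (m n) v with hP
  have hfi : Integrable f P := .of_bound hf.aestronglyMeasurable C hC
  have hf2 : Integrable (fun y => f y ^ 2) P :=
    .of_bound (by fun_prop) (C ^ 2) (hC.mono fun y hy => by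
      rw [Real.norm_eq_abs, abs_pow]; gcongr)
  have hL := integrable_piRatio m δ hv
  have hL2 := integrable_piRatio_sq m δ hv
  have hLf : Integrable (fun y => piRatio m δ v y * f y) P :=
    hL.mul_bdd (c := C) hf.aestronglyMeasurable hC
  rw [integral_pi_complexGaussian_add m δ hv, ← hP, ← integral_sub hLf hfi]
  set A := ∫ y, f y ^ 2 ∂P with hA
  set B := ∫ y, (piRatio m δ v y * f y - f y) ∂P with hB
  set S := Real.exp (2 * (∑ n, ‖δ n‖ ^ 2) / v) - 1 with hS
  -- Cauchy–Schwarz by discriminant: the quadratic is the second moment of `c f - (L - 1)`, with `L`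
  -- the likelihood ratio. The function `f` need not be centred, since a second moment replaces the
  -- variance.
  have key : ∀ c : ℝ, 0 ≤ A * (c * c) + (-2 * B) * c + S := by
    intro c
    have h1 : ∫ y, (c * f y - (piRatio m δ v y - 1)) ^ 2 ∂P = A * (c * c) + (-2 * B) * c + S := by
      have e : (fun y => (c * f y - (piRatio m δ v y - 1)) ^ 2) = fun y =>
          (c * c * f y ^ 2 + (-2 * c) * (piRatio m δ v y * f y - f y)) +
            (piRatio m δ v y ^ 2 - 2 * piRatio m δ v y + 1) := by
        funext y; ring
      rw [e, integral_add (by fun_prop) (by fun_prop), integral_add (by fun_prop) (by fun_prop),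
        integral_add (by fun_prop) (by fun_prop), integral_sub (by fun_prop) (by fun_prop),
        integral_const_mul, integral_const_mul, integral_const_mul, integral_piRatio m δ hv,
        integral_piRatio_sq m δ hv, ← hB, ← hA, hS]
      simp only [integral_const, probReal_univ, smul_eq_mul]
      ring
    rw [← h1]
    exact integral_nonneg fun y => sq_nonneg _
  have := discrim_le_zero key
  rw [discrim] at this
  nlinarith

end product

end TensorMod

/-! ### Inverse Gram matrices, the Loewner order and the optimal direction. -/

section linearAlgebra

open Matrix
open scoped InnerProductSpace

theorem Matrix.PosDef.diag_re_pos {n : Type*} {A : Matrix n n ℂ} (hA : A.PosDef) (k : n) :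
    0 < (A k k).re :=
  (Complex.pos_iff.1 (hA.diag_pos (i := k))).1

variable {n : Type*} [Fintype n] [DecidableEq n]

theorem Matrix.PosSemidef.re_dotProduct_diagonal_le {A : Matrix n n ℂ} {η : ℝ} {D : n → ℂ}
    (h : (A - (η : ℂ) • diagonal D).PosSemidef) (c : n → ℂ) :
    η * ∑ l, (D l).re * ‖c l‖ ^ 2 ≤ (star c ⬝ᵥ A *ᵥ c).re := by
  have h1 := h.re_dotProduct_nonneg c
  have h2 : (star c ⬝ᵥ ((η : ℂ) • diagonal D) *ᵥ c).re = η * ∑ l, (D l).re * ‖c l‖ ^ 2 := by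
    rw [smul_mulVec, dotProduct_smul, smul_eq_mul, Complex.re_ofReal_mul]
    congr 1
    simp only [dotProduct, mulVec_diagonal, Complex.re_sum, Pi.star_apply]
    refine Finset.sum_congr rfl fun l _ => ?_
    rw [mul_left_comm, Complex.star_def, Complex.conj_mul', ← Complex.ofReal_pow, Complex.re_mul_ofReal]
  rw [sub_mulVec, dotProduct_sub] at h1
  have h3 : (star c ⬝ᵥ A *ᵥ c).re - (star c ⬝ᵥ ((η : ℂ) • diagonal D) *ᵥ c).re ≥ 0 := by
    simpa using h1
  linarith

theorem Matrix.PosSemidef.re_dotProduct_le_diagonal {A : Matrix n n ℂ} {η : ℝ} {D : n → ℂ}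
    (h : ((η : ℂ) • diagonal D - A).PosSemidef) (c : n → ℂ) :
    (star c ⬝ᵥ A *ᵥ c).re ≤ η * ∑ l, (D l).re * ‖c l‖ ^ 2 := by
  have h' : (-A - ((-η : ℝ) : ℂ) • diagonal D).PosSemidef := by
    convert h using 1
    push_cast
    rw [neg_smul]
    abel
  have := h'.re_dotProduct_diagonal_le c
  rw [neg_mulVec, dotProduct_neg, Complex.neg_re] at this
  linarith

/-- If `A ⪯ η diag A`, then `(A (diag A)⁻¹ A)_{kk} ≤ η A_{kk}`. -/
theorem Matrix.PosDef.sum_sq_col_div_diag_le {A : Matrix n n ℂ} (hA : A.PosDef) {η : ℝ}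
    (hη : 0 < η) (h : ((η : ℂ) • diagonal (fun l => A l l) - A).PosSemidef) (k : n) :
    ∑ l, ‖A l k‖ ^ 2 / (A l l).re ≤ η * (A k k).re := by
  set q := ∑ l, ‖A l k‖ ^ 2 / (A l l).re with hq
  -- `x = (diag A)⁻¹ A e_k`, so that `x* A e = q` and `x* (diag A) x = q`. Positivity of `A` at `e -
  -- η⁻¹ x` then yields `η⁻¹ q ≤ A_kk`.
  set x : n → ℂ := fun l => A l k / (A l l).re with hx
  set e : n → ℂ := Pi.single k 1 with he
  have hD := hA.diag_re_pos
  have hxx : (star x ⬝ᵥ A *ᵥ x).re ≤ η * q := by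
    refine (h.re_dotProduct_le_diagonal x).trans_eq ?_
    congr 1
    refine Finset.sum_congr rfl fun l _ => ?_
    have := (hD l).ne'
    rw [hx, norm_div, Complex.norm_real, Real.norm_of_nonneg (hD l).le]
    field_simp
  have hxe : star x ⬝ᵥ A *ᵥ e = (q : ℂ) := by
    rw [he, mulVec_single_one, dotProduct, hq, Complex.ofReal_sum]
    refine Finset.sum_congr rfl fun l _ => ?_
    simp only [hx, Pi.star_apply, star_div₀, Complex.star_def, Complex.conj_ofReal, col_apply]
    rw [div_mul_eq_mul_div, Complex.conj_mul']
    push_cast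
    rfl
  have hex : star e ⬝ᵥ A *ᵥ x = (q : ℂ) := by
    have h1 : star (star x ⬝ᵥ A *ᵥ e) = star e ⬝ᵥ A *ᵥ x := by
      rw [star_dotProduct, star_mulVec, ← dotProduct_mulVec, hA.isHermitian.eq]
      simp
    rw [← h1, hxe, Complex.star_def, Complex.conj_ofReal]
  have hee : (star e ⬝ᵥ A *ᵥ e).re = (A k k).re := by
    have : star e = Pi.single k 1 := by rw [he, ← Pi.single_star, star_one]
    rw [this, he, mulVec_single_one, single_one_dotProduct, col_apply]
  have h0 : 0 ≤ (star (e - ((η⁻¹ : ℝ) : ℂ) • x) ⬝ᵥ A *ᵥ (e - ((η⁻¹ : ℝ) : ℂ) • x)).re :=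
    hA.posSemidef.re_dotProduct_nonneg _
  rw [star_sub, star_smul, mulVec_sub, mulVec_smul, sub_dotProduct, dotProduct_sub, dotProduct_sub,
    smul_dotProduct, smul_dotProduct, dotProduct_smul, dotProduct_smul, hxe, hex,
    Complex.star_def, Complex.conj_ofReal] at h0
  simp only [smul_eq_mul, Complex.sub_re, Complex.re_ofReal_mul, Complex.ofReal_re, hee] at h0
  have h2 : η⁻¹ * (η⁻¹ * (star x ⬝ᵥ A *ᵥ x).re) ≤ η⁻¹ * q := by
    refine mul_le_mul_of_nonneg_left ?_ (by positivity)
    rwa [inv_mul_le_iff₀ hη]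
  have h3 : η⁻¹ * q ≤ (A k k).re := by linarith
  rwa [inv_mul_le_iff₀ hη] at h3

theorem Matrix.PosDef.one_le_of_le_diagonal {n : Type*} [DecidableEq n] {A : Matrix n n ℂ} (hA : A.PosDef) {η : ℝ}
    (h : ((η : ℂ) • diagonal (fun l => A l l) - A).PosSemidef) (k : n) : 1 ≤ η := by
  have h1 := (Complex.nonneg_iff.1 (h.diag_nonneg (i := k))).1
  simp only [sub_apply, smul_apply, diagonal_apply_eq, smul_eq_mul, Complex.sub_re,
    Complex.re_ofReal_mul] at h1
  have := hA.diag_re_pos k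
  by_contra! h2
  nlinarith

variable {E : Type*} [NormedAddCommGroup E] [InnerProductSpace ℂ E]

/-- The best direction in `⨁ₗ (w l)ᗮ` for the linear form `⟪a, · k⟫`, with respect to the quadratic
form `A⁻¹ ⊗ 1`. -/
theorem Matrix.PosDef.exists_direction {A Γ : Matrix n n ℂ} (hA : A.PosDef) (hΓ : Γ * A = 1)
    {w : n → E} (hw : ∀ l, ‖w l‖ = 1) {η : ℝ} (hη : 0 < η)
    (h : (A - (η : ℂ) • diagonal (fun l => A l l)).PosSemidef) (k : n) (a : E) :
    ∃ v : n → E, (∀ l, ⟪w l, v l⟫_ℂ = 0) ∧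
      (∑ l, ∑ m, Γ l m * ⟪v l, v m⟫_ℂ).re = (⟪a, v k⟫_ℂ).re ∧
      (A k k).re * ‖a‖ ^ 2 - ∑ l, ‖A l k‖ ^ 2 * ‖⟪w l, a⟫_ℂ‖ ^ 2 / (η * (A l l).re) ≤
        (⟪a, v k⟫_ℂ).re := by
  set H : Matrix n n ℂ := A ⊙ gram ℂ w with hH
  have hD := hA.diag_re_pos
  -- The Gram matrix of unit vectors has unit diagonal, so the Schur product leaves `diag A`
  -- unchanged.
  have hdiag : (A - (η : ℂ) • diagonal (fun l => A l l)) ⊙ gram ℂ w =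
      H - (η : ℂ) • diagonal (fun l => A l l) := by
    ext i j
    by_cases hij : i = j
    · subst hij
      simp [hH, hw, hadamard_apply, inner_self_eq_norm_sq_to_K]
    · simp [hH, hadamard_apply, hij]
  have hHle : (H - (η : ℂ) • diagonal (fun l => A l l)).PosSemidef := by
    rw [← hdiag]
    exact h.hadamard (posSemidef_gram ℂ w)
  have hHpos : H.PosDef := by
    have h1 : ((η : ℂ) • diagonal (fun l => A l l)).PosDef :=
      (Matrix.PosDef.diagonal fun l => hA.diag_pos).smul (by simpa using hη)
    simpa using h1.posSemidef_add hHle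
  set b : n → ℂ := fun l => A l k * ⟪w l, a⟫_ℂ with hb
  -- Lagrange multipliers: `⟪w l, v l⟫ = 0` for all `l` says exactly `H c = b`. Without the
  -- constraints the optimum would be `v l = A l k • a`.
  set c : n → ℂ := H⁻¹ *ᵥ b with hc
  have hHc : H *ᵥ c = b := by
    rw [hc, mulVec_mulVec, mul_nonsing_inv _ ((isUnit_iff_isUnit_det _).1 hHpos.isUnit), one_mulVec]
  set y : n → E := fun m => (if m = k then a else 0) - c m • w m with hy
  set v : n → E := fun l => ∑ m, A l m • y m with hv
  have hv' : ∀ l, v l = A l k • a - ∑ m, (A l m * c m) • w m := by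
    intro l
    simp [hv, hy, smul_sub, Finset.sum_sub_distrib, smul_smul]
  have hwv : ∀ l, ⟪w l, v l⟫_ℂ = 0 := by
    intro l
    rw [hv', inner_sub_right, inner_smul_right, inner_sum]
    have := congrFun hHc l
    simp only [mulVec, dotProduct, hH, hadamard_apply, gram_apply, hb] at this
    rw [← this, sub_eq_zero]
    refine Finset.sum_congr rfl fun m _ => ?_
    rw [inner_smul_right]
    ring
  have hΓv : ∀ l, ∑ m, Γ l m • v m = y l := by
    intro l
    simp only [hv, Finset.smul_sum, smul_smul]
    rw [Finset.sum_comm]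
    simp only [← Finset.sum_smul]
    have : ∀ j, ∑ m, Γ l m * A m j = (1 : Matrix n n ℂ) l j := fun j => by rw [← hΓ, mul_apply]
    simp [this, one_apply, ite_smul]
  have hbc : star b ⬝ᵥ c = star c ⬝ᵥ H *ᵥ c := by
    rw [← hHc, star_mulVec, ← dotProduct_mulVec, hHpos.isHermitian.eq]
  have hinner : ⟪a, v k⟫_ℂ = A k k * ‖a‖ ^ 2 - star b ⬝ᵥ c := by
    rw [hv', inner_sub_right, inner_smul_right, inner_sum, inner_self_eq_norm_sq_to_K]
    congr 1
    refine Finset.sum_congr rfl fun m _ => ?_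
    have hAkm : star (A m k) = A k m := hA.isHermitian.apply k m
    rw [inner_smul_right, Pi.star_apply, star_mul', hAkm, Complex.star_def, inner_conj_symm]
    ring
  refine ⟨v, hwv, ?_, ?_⟩
  · have h1 : ∑ l, ∑ m, Γ l m * ⟪v l, v m⟫_ℂ = ⟪v k, a⟫_ℂ := by
      have h2 : ∀ l, ∑ m, Γ l m * ⟪v l, v m⟫_ℂ = ⟪v l, y l⟫_ℂ := by
        intro l
        rw [← hΓv l, inner_sum]
        exact Finset.sum_congr rfl fun m _ => (inner_smul_right _ _ _).symm
      have h3 : ∀ l, ⟪v l, w l⟫_ℂ = 0 := fun l => inner_eq_zero_symm.1 (hwv l)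
      simp only [h2]
      rw [Finset.sum_eq_single k]
      · simp [hy, h3]
      · intro l _ hl
        simp [hy, h3, hl]
      · simp
    rw [h1]
    exact inner_re_symm (𝕜 := ℂ) _ _
  · have hre : (⟪a, v k⟫_ℂ).re = (A k k).re * ‖a‖ ^ 2 - (star b ⬝ᵥ c).re := by
      rw [hinner, Complex.sub_re, ← Complex.ofReal_pow, Complex.re_mul_ofReal]
    have h1 := hHle.re_dotProduct_diagonal_le c
    rw [← hbc] at h1
    -- Completing the square in each coordinate. With `b* c = c* H c ≥ η ∑ A_ll |c_l|²` this bounds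
    -- `b* H⁻¹ b` without inverting the Loewner order.
    have h2 : 2 * (star b ⬝ᵥ c).re - η * ∑ l, (A l l).re * ‖c l‖ ^ 2 ≤
        ∑ l, ‖A l k‖ ^ 2 * ‖⟪w l, a⟫_ℂ‖ ^ 2 / (η * (A l l).re) := by
      rw [dotProduct, Complex.re_sum, Finset.mul_sum, Finset.mul_sum, ← Finset.sum_sub_distrib]
      refine Finset.sum_le_sum fun l _ => ?_
      have h3 : ((star b) l * c l).re ≤ ‖b l‖ * ‖c l‖ := by
        refine (Complex.re_le_norm _).trans_eq ?_
        simp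
      have h4 : ‖A l k‖ ^ 2 * ‖⟪w l, a⟫_ℂ‖ ^ 2 = ‖b l‖ ^ 2 := by
        rw [hb, norm_mul, mul_pow]
      have h5 : 0 < η * (A l l).re := mul_pos hη (hD l)
      rw [h4, le_div_iff₀ h5]
      nlinarith [sq_nonneg (‖b l‖ - η * (A l l).re * ‖c l‖)]
    linarith

/-- The diagonal of an inverse Gram matrix consists of inverse squared distances. -/
theorem Matrix.inv_gram_diag_mul_norm_sq_residual {Γ A : Matrix n n ℂ} {s : n → E}
    (hs : ∀ l m, Γ l m = ⟪s l, s m⟫_ℂ) (hA : Γ * A = 1) (k : n)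
    [(Submodule.span ℂ (s '' {l | l ≠ k}))ᗮ.HasOrthogonalProjection] :
    A k k * ‖(Submodule.span ℂ (s '' {l | l ≠ k}))ᗮ.starProjection (s k)‖ ^ 2 = 1 := by
  set U := Submodule.span ℂ (s '' {l | l ≠ k}) with hU
  -- The dual vector of `s k`: `⟪s l, z⟫ = δ_{lk}`. It lies in `Uᗮ`, hence equals `A k k` times the
  -- projection of `s k`; pairing with `s k` gives the claim.
  set z : E := ∑ l, A l k • s l with hz
  have hsz : ∀ l, ⟪s l, z⟫_ℂ = (1 : Matrix n n ℂ) l k := by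
    intro l
    rw [← hA, mul_apply, hz, inner_sum]
    exact Finset.sum_congr rfl fun m _ => by rw [inner_smul_right, hs, mul_comm]
  have hzU : z ∈ Uᗮ := by
    rw [hU, Submodule.mem_orthogonal]
    intro u hu
    induction hu using Submodule.span_induction with
    | mem u hu =>
      obtain ⟨l, hl, rfl⟩ := hu
      rw [hsz, one_apply_ne hl]
    | zero => simp
    | add x y _ _ hx hy => rw [inner_add_left, hx, hy, add_zero]
    | smul r x _ hx => rw [inner_smul_left, hx, mul_zero]
  have hPz : Uᗮ.starProjection z = A k k • Uᗮ.starProjection (s k) := by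
    rw [hz, map_sum, Finset.sum_eq_single k]
    · rw [map_smul]
    · intro l _ hl
      rw [map_smul]
      have : s l ∈ Uᗮᗮ := Submodule.le_orthogonal_orthogonal _ (Submodule.subset_span ⟨l, hl, rfl⟩)
      rw [(Submodule.starProjection_apply_eq_zero_iff _).2 this, smul_zero]
    · simp
  have h1 : ⟪s k, Uᗮ.starProjection z⟫_ℂ = 1 := by
    rw [Submodule.starProjection_eq_self_iff.2 hzU, hsz, one_apply_eq]
  rw [hPz, inner_smul_right, ← Submodule.inner_starProjection_left_eq_right] at h1
  rw [← h1]
  congr 1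
  have h2 := Submodule.inner_starProjection_left_eq_right (K := Uᗮ) (s k) (Uᗮ.starProjection (s k))
  rw [Submodule.starProjection_eq_self_iff.2 (Submodule.starProjection_apply_mem _ _)] at h2
  rw [Submodule.inner_starProjection_left_eq_right, ← h2, inner_self_eq_norm_sq_to_K]
  rfl

end linearAlgebra

namespace TensorMod

open scoped InnerProductSpace

/-! ### Differentiating Gaussian expectations along a curve of means. -/

section curve

variable {ι : Type*} [Fintype ι] {v : ℝ} {m : ℝ → ι → ℂ} {m' : ι → ℂ}
  {f : (ι → ℂ) → ℝ} {C : ℝ}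

/-- The Hammersley–Chapman–Robbins bound squeezes the difference of expectations to zero. It serves
to recover the continuity of `α` along a curve, which is not assumed. -/
theorem tendsto_integral_pi_complexGaussian (hv : 0 < v) (hm : ∀ n, HasDerivAt (m · n) (m' n) 0)
    (hf : Measurable f) (hC : ∀ᵐ y ∂(Measure.pi fun n => complexGaussian (m 0 n) v), |f y| ≤ C) :
    Tendsto (fun t => ∫ y, f y ∂(Measure.pi fun n => complexGaussian (m t n) v)) (𝓝 0)
      (𝓝 (∫ y, f y ∂(Measure.pi fun n => complexGaussian (m 0 n) v))) := by
  have hbound : ∀ t, ((∫ y, f y ∂(Measure.pi fun n => complexGaussian (m t n) v)) -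
        ∫ y, f y ∂(Measure.pi fun n => complexGaussian (m 0 n) v)) ^ 2 ≤
      (∫ y, f y ^ 2 ∂(Measure.pi fun n => complexGaussian (m 0 n) v)) *
        (Real.exp (2 * (∑ n, ‖m t n - m 0 n‖ ^ 2) / v) - 1) := fun t => by
    simpa using sq_integral_sub_integral_le (m 0) (m t - m 0) hv hf hC
  have hcont : ∀ n, Tendsto (m · n) (𝓝 0) (𝓝 (m 0 n)) := fun n => (hm n).continuousAt
  have hlim : Tendsto (fun t => (∫ y, f y ^ 2 ∂(Measure.pi fun n => complexGaussian (m 0 n) v)) *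
      (Real.exp (2 * (∑ n, ‖m t n - m 0 n‖ ^ 2) / v) - 1)) (𝓝 0) (𝓝 0) := by
    have h1 : Tendsto (fun t => ∑ n, ‖m t n - m 0 n‖ ^ 2) (𝓝 0) (𝓝 0) := by
      have := tendsto_finsetSum Finset.univ
        fun n _ => (((hcont n).sub_const (m 0 n)).norm.pow 2)
      simpa using this
    have h2 := (((Real.continuous_exp.tendsto _).comp
      ((h1.const_mul 2).div_const v)).sub_const 1).const_mul
        (∫ y, f y ^ 2 ∂(Measure.pi fun n => complexGaussian (m 0 n) v))
    simpa using h2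
  have hsq := squeeze_zero (fun t => sq_nonneg _) hbound hlim
  have := hsq.sqrt
  simp only [Real.sqrt_sq_eq_abs, Real.sqrt_zero] at this
  exact tendsto_sub_nhds_zero_iff.1 ((tendsto_zero_iff_abs_tendsto_zero _).2 this)

/-- The Cramér–Rao bound along a differentiable curve of means of a complex Gaussian vector. -/
theorem sq_deriv_integral_le (hv : 0 < v) (hm : ∀ n, HasDerivAt (m · n) (m' n) 0)
    (hf : Measurable f) (hC : ∀ᵐ y ∂(Measure.pi fun n => complexGaussian (m 0 n) v), |f y| ≤ C)
    {L : ℝ} (hL : Tendsto (fun t => t⁻¹ *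
      ((∫ y, f y ∂(Measure.pi fun n => complexGaussian (m t n) v)) -
        ∫ y, f y ∂(Measure.pi fun n => complexGaussian (m 0 n) v))) (𝓝[≠] 0) (𝓝 L)) :
    L ^ 2 ≤ (∫ y, f y ^ 2 ∂(Measure.pi fun n => complexGaussian (m 0 n) v)) *
      (2 * (∑ n, ‖m' n‖ ^ 2) / v) := by
  set A := ∫ y, f y ^ 2 ∂(Measure.pi fun n => complexGaussian (m 0 n) v) with hA
  have hA0 : 0 ≤ A := integral_nonneg fun y => sq_nonneg _
  set h : ℝ → ℝ := fun t => 2 * (∑ n, ‖m t n - m 0 n‖ ^ 2) / v with hh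
  have hslope : Tendsto (fun t => (t⁻¹) ^ 2 * h t) (𝓝[≠] 0)
      (𝓝 (2 * (∑ n, ‖m' n‖ ^ 2) / v)) := by
    have h1 := tendsto_finsetSum Finset.univ
      fun n _ => ((hasDerivAt_iff_tendsto_slope_zero.1 (hm n)).norm.pow 2)
    refine ((h1.const_mul 2).div_const v).congr fun t => ?_
    simp only [hh, zero_add, norm_smul, mul_pow, ← Finset.mul_sum, norm_inv, Real.norm_eq_abs,
      inv_pow, sq_abs]
    ring
  have hh0 : Tendsto h (𝓝[≠] 0) (𝓝 0) := by
    have h1 : Tendsto (fun t : ℝ => t ^ 2) (𝓝[≠] 0) (𝓝 0) := by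
      have : Tendsto (fun t : ℝ => t ^ 2) (𝓝 0) (𝓝 (0 ^ 2)) := tendsto_id.pow 2
      simpa using this.mono_left nhdsWithin_le_nhds
    have h2 := h1.mul hslope
    rw [zero_mul] at h2
    refine h2.congr' ?_
    filter_upwards [self_mem_nhdsWithin] with t ht
    have ht : t ≠ 0 := ht
    field_simp
  have hlim : Tendsto (fun t => A * ((t⁻¹) ^ 2 * h t * Real.exp (h t))) (𝓝[≠] 0)
      (𝓝 (A * (2 * (∑ n, ‖m' n‖ ^ 2) / v))) := by
    have := (hslope.mul ((Real.continuous_exp.tendsto _).comp hh0)).const_mul A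
    simpa using this
  refine le_of_tendsto_of_tendsto (hL.pow 2) hlim (Eventually.of_forall fun t => ?_)
  have h1 := sq_integral_sub_integral_le (m 0) (m t - m 0) hv hf hC
  simp only [Pi.sub_apply, add_sub_cancel] at h1
  -- This is `1 - h ≤ exp (-h)` multiplied by `exp h`; after division by `t²` the extra factor tends
  -- to `1`.
  have h2 : Real.exp (h t) - 1 ≤ h t * Real.exp (h t) := by
    have h3 := mul_le_mul_of_nonneg_right (Real.add_one_le_exp (-h t)) (Real.exp_pos (h t)).le
    rw [← Real.exp_add, neg_add_cancel, Real.exp_zero] at h3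
    linarith
  calc _ = (t⁻¹) ^ 2 * _ := mul_pow _ _ _
    _ ≤ (t⁻¹) ^ 2 * (A * (h t * Real.exp (h t))) := by
      refine mul_le_mul_of_nonneg_left (h1.trans ?_) (sq_nonneg _)
      exact mul_le_mul_of_nonneg_left h2 hA0
    _ = _ := by ring

end curve

/-! ### The tensor signal and its information in one mode. -/

variable {d : ℕ} {T : Fin (d + 1) → ℕ} {K : ℕ} {σ : ℝ} {θ : Param T K}

/-- The signal is linear in each mode, so its derivative along a curve in mode `j` is the signal
with that mode replaced by the velocity. -/
theorem signal_update (θ : Param T K) (j : Fin (d + 1))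
    (u : Fin K → EuclideanSpace ℂ (Fin (T j))) (n : ∀ i, Fin (T i)) :
    signal (Function.update θ j u) n =
      ∑ k, u k (n j) * partialKron θ j k (fun i : {i // i ≠ j} => n i) := by
  refine Finset.sum_congr rfl fun k _ => ?_
  rw [Fintype.prod_eq_mul_prod_subtype_ne _ j, Function.update_self]
  congr 1
  refine Finset.prod_congr rfl fun i _ => ?_
  rw [Function.update_of_ne i.2]

theorem Gam_apply (θ : Param T K) (j : Fin (d + 1)) (l m : Fin K) :
    Gam θ j l m = ⟪partialKron θ j l, partialKron θ j m⟫_ℂ := by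
  simp only [Gam, kronMatrix, Matrix.mul_apply, Matrix.conjTranspose_apply, Matrix.of_apply,
    PiLp.inner_apply, RCLike.inner_apply, Complex.star_def]
  exact Finset.sum_congr rfl fun _ _ => mul_comm _ _

/-- Up to the factor `2 / σ²`, this is the Fisher information for mode `j`: splitting off the index
`n j` factors the sum into the form `Γ ⊗ 1`. -/
theorem sum_norm_sq_signal_update (θ : Param T K) (j : Fin (d + 1))
    (u : Fin K → EuclideanSpace ℂ (Fin (T j))) :
    ∑ n, ‖signal (Function.update θ j u) n‖ ^ 2 =
      (∑ l, ∑ m, Gam θ j l m * ⟪u l, u m⟫_ℂ).re := by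
  have h1 : ∀ n, (‖signal (Function.update θ j u) n‖ ^ 2 : ℝ) =
      (∑ l, ∑ m, (starRingEnd ℂ (u l (n j)) * u m (n j)) *
        (starRingEnd ℂ (partialKron θ j l (fun i : {i // i ≠ j} => n i)) *
          partialKron θ j m (fun i : {i // i ≠ j} => n i))).re := by
    intro n
    rw [← Complex.ofReal_re (‖signal (Function.update θ j u) n‖ ^ 2), Complex.ofReal_pow,
      ← Complex.conj_mul', signal_update, map_sum, Finset.sum_mul_sum]
    congr 1
    refine Finset.sum_congr rfl fun l _ => Finset.sum_congr rfl fun m _ => ?_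
    rw [map_mul]
    ring
  simp only [h1]
  rw [← Complex.re_sum, Finset.sum_comm]
  congr 1
  refine Finset.sum_congr rfl fun l _ => ?_
  rw [Finset.sum_comm]
  refine Finset.sum_congr rfl fun m _ => ?_
  rw [Gam_apply, PiLp.inner_apply, PiLp.inner_apply, Finset.sum_mul_sum, Finset.sum_comm,
    ← Fintype.sum_prod_type']
  refine Fintype.sum_equiv (Equiv.piSplitAt j _) _ _ fun n => ?_
  simp only [Equiv.piSplitAt_apply, RCLike.inner_apply]
  ring

theorem hasDerivAt_signal_update {j : Fin (d + 1)}
    {x : ℝ → Fin K → EuclideanSpace ℂ (Fin (T j))} {v : Fin K → EuclideanSpace ℂ (Fin (T j))}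
    (hx : ∀ k, HasDerivAt (x · k) (v k) 0) (n : ∀ i, Fin (T i)) :
    HasDerivAt (fun t => signal (Function.update θ j (x t)) n)
      (signal (Function.update θ j v) n) 0 := by
  simp only [signal_update]
  refine HasDerivAt.fun_sum fun k _ => HasDerivAt.mul_const ?_ _
  exact (PiLp.proj (𝕜 := ℝ) 2 (fun _ : Fin (T j) => ℂ) (n j)).hasFDerivAt.comp_hasDerivAt 0 (hx k)

/-- Transfers the almost sure constraints, hence boundedness of the estimator, from the law at `θ`
to the laws at nearby parameters. -/
theorem law_absolutelyContinuous (hσ : 0 < σ) (θ θ' : Param T K) : law σ θ' ≪ law σ θ := by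
  have h := pi_complexGaussian_add_eq_withDensity (signal θ) (signal θ' - signal θ) (sq_pos_of_pos hσ)
  simp only [Pi.sub_apply, add_sub_cancel] at h
  rw [law, h]
  exact withDensity_absolutelyContinuous _ _

instance : IsProbabilityMeasure (law σ θ) := by
  unfold law
  infer_instance

/-! ### Moments of a constrained estimator. -/

section estimator

variable {est : Obs T → Param T K}

theorem measurable_est (hest : Measurable est) (i : Fin (d + 1)) (k : Fin K) :
    Measurable fun y => est y i k :=
  (measurable_pi_apply k).comp ((measurable_pi_apply i).comp hest)

theorem SatisfiesConstraints.ae_norm_sq (hcons : SatisfiesConstraints σ θ est) (i : Fin d)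
    (k : Fin K) : ∀ᵐ y ∂(law σ θ), ‖est y i.castSucc k‖ ^ 2 = T i.castSucc :=
  hcons.mono fun _ hy => (hy i k).1

theorem SatisfiesConstraints.ae_norm (hcons : SatisfiesConstraints σ θ est) (i : Fin d)
    (k : Fin K) : ∀ᵐ y ∂(law σ θ), ‖est y i.castSucc k‖ = √(T i.castSucc) :=
  (hcons.ae_norm_sq i k).mono fun y hy => by rw [← hy, Real.sqrt_sq (norm_nonneg _)]

theorem SatisfiesConstraints.integrable (hcons : SatisfiesConstraints σ θ est) (hσ : 0 < σ)
    (hest : Measurable est) (θ' : Param T K) (i : Fin d) (k : Fin K) :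
    Integrable (fun y => est y i.castSucc k) (law σ θ') :=
  .of_bound (measurable_est hest _ _).aestronglyMeasurable (√(T i.castSucc))
    ((law_absolutelyContinuous hσ θ θ').ae_le ((hcons.ae_norm i k).mono fun _ hy => hy.le))

theorem SatisfiesConstraints.integral_re_inner (hcons : SatisfiesConstraints σ θ est) (hσ : 0 < σ)
    (hest : Measurable est) (θ' : Param T K) (i : Fin d) (k : Fin K)
    (a : EuclideanSpace ℂ (Fin (T i.castSucc))) :
    ∫ y, (⟪a, est y i.castSucc k⟫_ℂ).re ∂(law σ θ') = (⟪a, mean σ θ' est i k⟫_ℂ).re := by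
  have hint := hcons.integrable hσ hest θ' i k
  rw [mean, ← integral_inner hint a]
  exact integral_re (𝕜 := ℂ) (hint.const_inner a)

/-- The mean square distance of the estimator to a real multiple of the true parameter. -/
theorem SatisfiesConstraints.integral_norm_sub_sq (hcons : SatisfiesConstraints σ θ est)
    (hσ : 0 < σ) (hθ : ∀ (i : Fin d) (k : Fin K), ‖θ i.castSucc k‖ ^ 2 = (T i.castSucc : ℝ))
    (hest : Measurable est) {α : Fin d → Fin K → ℝ} (hα : HasScalarBias σ θ est α)
    (i : Fin d) (k : Fin K) (β : ℝ) :
    ∫ y, ‖est y i.castSucc k - (β : ℂ) • θ i.castSucc k‖ ^ 2 ∂(law σ θ) =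
      T i.castSucc * (1 - 2 * β * α i k + β ^ 2) := by
  -- With both norms fixed, the squared distance is affine in `Re⟪x, ẑ⟫`, so only the mean of `ẑ`
  -- matters.
  have h1 : ∀ᵐ y ∂(law σ θ), ‖est y i.castSucc k - (β : ℂ) • θ i.castSucc k‖ ^ 2 =
      T i.castSucc * (1 + β ^ 2) - 2 * β * (⟪θ i.castSucc k, est y i.castSucc k⟫_ℂ).re := by
    filter_upwards [hcons.ae_norm_sq i k] with y hy
    rw [norm_sub_sq (𝕜 := ℂ), inner_smul_right, hy, norm_smul, mul_pow, hθ, Complex.norm_real,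
      Real.norm_eq_abs, sq_abs, RCLike.re_to_complex, Complex.re_ofReal_mul]
    rw [← inner_conj_symm, Complex.conj_re]
    ring
  have hint : Integrable (fun y => (⟪θ i.castSucc k, est y i.castSucc k⟫_ℂ).re) (law σ θ) :=
    ((hcons.integrable hσ hest θ i k).const_inner (𝕜 := ℂ) _).re
  rw [integral_congr_ae h1, integral_sub (integrable_const _) (hint.const_mul _),
    integral_const_mul (2 * β), hcons.integral_re_inner hσ hest, (hα i k).2, inner_smul_right,
    Complex.re_ofReal_mul, inner_self_eq_norm_sq_to_K, ← RCLike.ofReal_pow, hθ]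
  simp
  ring

end estimator

/-- A curve on the sphere through `x`, with velocity `v` if `v` is orthogonal to `x`. -/
noncomputable def constraintCurve {E : Type*} [NormedAddCommGroup E] [NormedSpace ℝ E] (x v : E)
    (t : ℝ) : E :=
  (√(1 + t ^ 2 * (‖v‖ ^ 2 / ‖x‖ ^ 2)))⁻¹ • (x + t • v)

/-! ### Curves inside the constraint set. -/

section constraintCurve

variable {n : ℕ} {x v : EuclideanSpace ℂ (Fin n)}

theorem constraintCurve_zero : constraintCurve x v 0 = x := by
  simp [constraintCurve]

theorem hasDerivAt_constraintCurve : HasDerivAt (constraintCurve x v) v 0 := by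
  have h1 : HasDerivAt (fun t : ℝ => 1 + t ^ 2 * (‖v‖ ^ 2 / ‖x‖ ^ 2)) 0 0 := by
    have := (((hasDerivAt_id (0 : ℝ)).fun_pow 2).mul_const (‖v‖ ^ 2 / ‖x‖ ^ 2)).const_add 1
    simpa using this
  have h2 := (h1.sqrt (by simp)).fun_inv (by simp)
  have h3 : HasDerivAt (fun t : ℝ => x + t • v) v 0 := by
    simpa using ((hasDerivAt_id (0 : ℝ)).smul_const v).const_add x
  have h4 := h2.fun_smul h3
  convert! h4 using 1
  simp

theorem norm_constraintCurve_sq (hx : x ≠ 0) (hv : ⟪x, v⟫_ℂ = 0) (t : ℝ) :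
    ‖constraintCurve x v t‖ ^ 2 = ‖x‖ ^ 2 := by
  have h1 : ‖x + t • v‖ ^ 2 = ‖x‖ ^ 2 + t ^ 2 * ‖v‖ ^ 2 := by
    rw [norm_add_sq (𝕜 := ℂ), inner_smul_right_eq_smul, hv, norm_smul, mul_pow, Real.norm_eq_abs,
      sq_abs]
    simp
  have hx' := norm_pos_iff.2 hx
  rw [constraintCurve, norm_smul, mul_pow, h1, norm_inv, Real.norm_eq_abs, inv_pow, sq_abs,
    Real.sq_sqrt (by positivity)]
  field_simp

/-- Complex orthogonality linearises both constraints at once: its real part is tangency to the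
sphere, its imaginary part the phase condition. -/
theorem inner_constraintCurve_im (hv : ⟪x, v⟫_ℂ = 0) (t : ℝ) :
    (⟪x, constraintCurve x v t⟫_ℂ).im = 0 := by
  rw [constraintCurve, inner_smul_right_eq_smul, inner_add_right, inner_smul_right_eq_smul, hv,
    inner_self_eq_norm_sq_to_K, ← RCLike.ofReal_pow, smul_zero, add_zero, Complex.smul_im]
  simp [-Complex.ofReal_pow]

end constraintCurve

end TensorMod

/-! ### Cramér–Rao bounds under scalar bias. -/

namespace TensorMod

open scoped InnerProductSpace

variable {d : ℕ} {T : Fin (d + 1) → ℕ} {K : ℕ} {σ : ℝ} {θ : Param T K} {est : Obs T → Param T K}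

theorem hasDerivAt_update {j : Fin (d + 1)} {x : ℝ → Fin K → EuclideanSpace ℂ (Fin (T j))}
    {v : Fin K → EuclideanSpace ℂ (Fin (T j))} (hx : ∀ k, HasDerivAt (x · k) (v k) 0) :
    HasDerivAt (fun t => (Function.update θ j (x t) : Param T K)) (Function.update 0 j v) 0 := by
  refine hasDerivAt_pi.2 fun j' => ?_
  by_cases h : j' = j
  · subst h
    simpa using hasDerivAt_pi.2 hx
  · simpa [h] using hasDerivAt_const (0 : ℝ) (θ j')

/-- The Cramér–Rao bound for an estimator with scalar bias, in a tangent direction `v` of the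
constraint set. -/
theorem HasScalarBiasNear.sq_mul_re_inner_le {α : Param T K → Fin d → Fin K → ℝ}
    (hα : HasScalarBiasNear σ θ est α) (hσ : 0 < σ)
    (hθ : ∀ (i : Fin d) (k : Fin K), ‖θ i.castSucc k‖ ^ 2 = (T i.castSucc : ℝ))
    (hest : Measurable est) (hcons : SatisfiesConstraints σ θ est) (i : Fin d) (k : Fin K)
    {v : Fin K → EuclideanSpace ℂ (Fin (T i.castSucc))} (hT : 0 < T i.castSucc)
    (hv : ∀ l, ⟪θ i.castSucc l, v l⟫_ℂ = 0) {a : EuclideanSpace ℂ (Fin (T i.castSucc))}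
    (ha : ⟪θ i.castSucc k, a⟫_ℂ = 0) :
    (α θ i k * (⟪a, v k⟫_ℂ).re) ^ 2 ≤
      (∫ y, (⟪a, est y i.castSucc k⟫_ℂ).re ^ 2 ∂(law σ θ)) *
        (2 * (∑ l, ∑ m, Gam θ i.castSucc l m * ⟪v l, v m⟫_ℂ).re / σ ^ 2) := by
  have hT' : (0 : ℝ) < T i.castSucc := by exact_mod_cast hT
  have hθ0 : ∀ l, θ i.castSucc l ≠ 0 := fun l h => by
    have := hθ i l
    rw [h, norm_zero] at this
    simp only [ne_eq, OfNat.ofNat_ne_zero, not_false_eq_true, zero_pow] at this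
    linarith
  set x : ℝ → Fin K → EuclideanSpace ℂ (Fin (T i.castSucc)) :=
    fun t l => constraintCurve (θ i.castSucc l) (v l) t with hx
  have hxd : ∀ l, HasDerivAt (x · l) (v l) 0 := fun l => hasDerivAt_constraintCurve
  set ϑ : ℝ → Param T K := fun t => Function.update θ i.castSucc (x t) with hϑ
  have hx0 : x 0 = θ i.castSucc := funext fun l => constraintCurve_zero
  have hϑ0 : ϑ 0 = θ := by
    simp only [hϑ, hx0]
    exact Function.update_eq_self _ _
  have hϑd : HasDerivAt ϑ _ 0 := hasDerivAt_update hxd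
  have hϑi : ∀ t, ϑ t i.castSucc = x t := fun t => Function.update_self _ _ _
  have hϑmem : ∀ t, ϑ t ∈ constraintSet θ := by
    intro t i' l
    by_cases h : i' = i
    · subst h
      rw [hϑi]
      exact ⟨(norm_constraintCurve_sq (hθ0 l) (hv l) t).trans (hθ i' l),
        inner_constraintCurve_im (hv l) t⟩
    · have h' : i'.castSucc ≠ i.castSucc := fun e => h (Fin.castSucc_injective _ e)
      simp only [hϑ, Function.update_of_ne h']
      refine ⟨hθ i' l, ?_⟩
      rw [inner_self_eq_norm_sq_to_K, ← RCLike.ofReal_pow]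
      exact Complex.ofReal_im _
  have hϑlim : Tendsto ϑ (𝓝 0) (𝓝[constraintSet θ] θ) := by
    refine tendsto_nhdsWithin_iff.2 ⟨?_, Eventually.of_forall hϑmem⟩
    have := hϑd.continuousAt.tendsto
    rwa [hϑ0] at this
  set R : ℝ → EuclideanSpace ℂ (Fin (T i.castSucc)) :=
    fun t => mean σ (ϑ t) est i k - (α (ϑ t) i k : ℂ) • x t k with hR
  have hRo : R =o[𝓝 0] (fun t : ℝ => t) := by
    have h1 := (hα.bias_near i k).comp_tendsto hϑlim
    have h2 := hϑd.isBigO_sub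
    rw [hϑ0] at h2
    have h3 := h1.trans_isBigO h2
    refine IsLittleO.congr h3 (fun t => ?_) (fun t => sub_zero t)
    simp only [Function.comp_apply, hR, hϑi]
  have hmean : ∀ (b : EuclideanSpace ℂ (Fin (T i.castSucc))) t,
      ∫ y, (⟪b, est y i.castSucc k⟫_ℂ).re ∂(law σ (ϑ t)) =
        α (ϑ t) i k * (⟪b, x t k⟫_ℂ).re + (⟪b, R t⟫_ℂ).re := by
    intro b t
    rw [hcons.integral_re_inner hσ hest, hR, inner_sub_right, inner_smul_right, Complex.sub_re,
      Complex.re_ofReal_mul]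
    ring
  have hmeas : ∀ b : EuclideanSpace ℂ (Fin (T i.castSucc)),
      Measurable fun y => (⟪b, est y i.castSucc k⟫_ℂ).re := fun b =>
    Complex.measurable_re.comp ((measurable_est hest _ _).const_inner)
  have hbdd : ∀ b : EuclideanSpace ℂ (Fin (T i.castSucc)),
      ∀ᵐ y ∂(law σ (ϑ 0)), |(⟪b, est y i.castSucc k⟫_ℂ).re| ≤ ‖b‖ * √(T i.castSucc) := by
    intro b
    rw [hϑ0]
    filter_upwards [hcons.ae_norm i k] with y hy
    rw [← hy]
    exact (Complex.abs_re_le_norm _).trans (norm_inner_le_norm _ _)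
  have hsig : ∀ n, HasDerivAt (fun t => signal (ϑ t) n)
      (signal (Function.update θ i.castSucc v) n) 0 := fun n => hasDerivAt_signal_update hxd n
  have hre : ∀ b : EuclideanSpace ℂ (Fin (T i.castSucc)),
      Continuous fun z : EuclideanSpace ℂ (Fin (T i.castSucc)) => (⟪b, z⟫_ℂ).re := fun b =>
    Complex.continuous_re.comp (continuous_const.inner continuous_id)
  -- Pairing the bias identity with `x_k` writes `α` as a quotient of continuous quantities, up to
  -- the vanishing remainder; the denominator tends to `T ≠ 0`.
  have hαlim : Tendsto (fun t => α (ϑ t) i k) (𝓝 0) (𝓝 (α θ i k)) := by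
    have h1 := tendsto_integral_pi_complexGaussian (m := fun t => signal (ϑ t))
      (sq_pos_of_pos hσ) hsig (hmeas (θ i.castSucc k)) (hbdd (θ i.castSucc k))
    change Tendsto (fun t => ∫ y, _ ∂(law σ (ϑ t))) _ (𝓝 (∫ y, _ ∂(law σ (ϑ 0)))) at h1
    have hR0 : Tendsto R (𝓝 0) (𝓝 0) := hRo.trans_tendsto tendsto_id
    have h2 := ((hre (θ i.castSucc k)).tendsto _).comp hR0
    have h3 : Tendsto (fun t => (⟪θ i.castSucc k, x t k⟫_ℂ).re) (𝓝 0) (𝓝 (T i.castSucc)) := by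
      have := ((hre (θ i.castSucc k)).tendsto _).comp (hxd k).continuousAt.tendsto
      rw [hx0, inner_self_eq_norm_sq_to_K, ← RCLike.ofReal_pow, hθ] at this
      exact this
    have h4 := (h1.sub h2).div h3 hT'.ne'
    have hval : ∫ y, (⟪θ i.castSucc k, est y i.castSucc k⟫_ℂ).re ∂(law σ (ϑ 0)) =
        α θ i k * T i.castSucc := by
      rw [hϑ0, hcons.integral_re_inner hσ hest, (hα.bias_self i k).2, inner_smul_right,
        Complex.re_ofReal_mul, inner_self_eq_norm_sq_to_K, ← RCLike.ofReal_pow, hθ]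
      rfl
    rw [hval, inner_zero_right, Complex.zero_re, sub_zero, mul_div_cancel_right₀ _ hT'.ne'] at h4
    refine h4.congr' ?_
    filter_upwards [h3.eventually_ne hT'.ne'] with t ht
    simp only [Pi.div_apply, hmean, Function.comp_apply, add_sub_cancel_right]
    exact mul_div_cancel_right₀ _ ht
  have hg0 : ∫ y, (⟪a, est y i.castSucc k⟫_ℂ).re ∂(law σ (ϑ 0)) = 0 := by
    rw [hϑ0, hcons.integral_re_inner hσ hest, (hα.bias_self i k).2, inner_smul_right,
      inner_eq_zero_symm.1 ha, mul_zero, Complex.zero_re]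
  -- Since `⟪a, x_k⟫ = 0`, the factor multiplying `α` already vanishes at `t = 0`: continuity of `α`
  -- suffices, with no derivative.
  have hL : Tendsto (fun t => t⁻¹ * ((∫ y, (⟪a, est y i.castSucc k⟫_ℂ).re ∂(law σ (ϑ t))) -
      ∫ y, (⟪a, est y i.castSucc k⟫_ℂ).re ∂(law σ (ϑ 0)))) (𝓝[≠] 0)
      (𝓝 (α θ i k * (⟪a, v k⟫_ℂ).re)) := by
    have h1 : Tendsto (fun t : ℝ => t⁻¹ • R t) (𝓝[≠] 0) (𝓝 0) :=
      (hRo.mono nhdsWithin_le_nhds).tendsto_inv_smul_nhds_zero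
    have h2 := ((hre a).tendsto _).comp h1
    have h3 := ((hre a).tendsto _).comp (hasDerivAt_iff_tendsto_slope_zero.1 (hxd k))
    have h4 := ((hαlim.mono_left nhdsWithin_le_nhds).mul h3).add h2
    rw [inner_zero_right, Complex.zero_re, add_zero] at h4
    refine h4.congr fun t => ?_
    rw [hg0, hmean]
    simp only [Function.comp_apply, zero_add, hx0, inner_smul_right_eq_smul, inner_sub_right,
      inner_eq_zero_symm.1 ha, sub_zero, Complex.smul_re, smul_eq_mul]
    ring
  have := sq_deriv_integral_le (m := fun t => signal (ϑ t)) (sq_pos_of_pos hσ) hsig (hmeas a)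
    (hbdd a) hL
  change _ ≤ (∫ y, _ ∂(law σ (ϑ 0))) * _ at this
  rwa [hϑ0, sum_norm_sq_signal_update] at this

open Matrix

theorem Gam_posSemidef (θ : Param T K) (j : Fin (d + 1)) : (Gam θ j).PosSemidef :=
  posSemidef_conjTranspose_mul_self _

theorem Gam_inv_posDef {j : Fin (d + 1)} (hΓ : IsUnit (Gam θ j)) : (Gam θ j)⁻¹.PosDef :=
  ((Gam_posSemidef θ j).posDef_iff_isUnit.2 hΓ).inv

/-- In the direction of `exists_direction` the quadratic form equals the linear form, so one factor
cancels from the Cramér–Rao inequality. The real bound carries `σ² / 2`; the real and imaginary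
parts together give `σ²`. -/
theorem HasScalarBiasNear.le_integral_norm_inner_sq {α : Param T K → Fin d → Fin K → ℝ}
    (hα : HasScalarBiasNear σ θ est α) (hσ : 0 < σ)
    (hθ : ∀ (i : Fin d) (k : Fin K), ‖θ i.castSucc k‖ ^ 2 = (T i.castSucc : ℝ))
    (hest : Measurable est) (hcons : SatisfiesConstraints σ θ est) (i : Fin d) (k : Fin K)
    (hT : 0 < T i.castSucc) (hΓ : IsUnit (Gam θ i.castSucc)) {η : ℝ} (hη : 0 < η)
    (h : ((Gam θ i.castSucc)⁻¹ - (η : ℂ) • diagInv θ i.castSucc).PosSemidef)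
    {a : EuclideanSpace ℂ (Fin (T i.castSucc))} (ha : ⟪θ i.castSucc k, a⟫_ℂ = 0) :
    σ ^ 2 * α θ i k ^ 2 * (((Gam θ i.castSucc)⁻¹ k k).re * ‖a‖ ^ 2 -
      ∑ l, ‖(Gam θ i.castSucc)⁻¹ l k‖ ^ 2 *
        ‖⟪((√(T i.castSucc))⁻¹ : ℂ) • θ i.castSucc l, a⟫_ℂ‖ ^ 2 /
          (η * ((Gam θ i.castSucc)⁻¹ l l).re)) ≤
      ∫ y, ‖⟪a, est y i.castSucc k⟫_ℂ‖ ^ 2 ∂(law σ θ) := by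
  have hT' : (0 : ℝ) < T i.castSucc := by exact_mod_cast hT
  have hsq : (√(T i.castSucc) : ℂ) ≠ 0 := by
    simpa using hT.ne'
  have hA := Gam_inv_posDef hΓ
  have hΓA : Gam θ i.castSucc * (Gam θ i.castSucc)⁻¹ = 1 :=
    mul_nonsing_inv _ ((isUnit_iff_isUnit_det _).1 hΓ)
  set w : Fin K → EuclideanSpace ℂ (Fin (T i.castSucc)) :=
    fun l => ((√(T i.castSucc))⁻¹ : ℂ) • θ i.castSucc l with hw
  have hw1 : ∀ l, ‖w l‖ = 1 := by
    intro l
    have h1 : ‖θ i.castSucc l‖ = √(T i.castSucc) := by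
      rw [← hθ i l, Real.sqrt_sq (norm_nonneg _)]
    have h2 : √(T i.castSucc : ℝ) ≠ 0 := by positivity
    rw [hw, norm_smul, h1, norm_inv, Complex.norm_real, Real.norm_of_nonneg (Real.sqrt_nonneg _),
      inv_mul_cancel₀ h2]
  have hreal : ∀ b : EuclideanSpace ℂ (Fin (T i.castSucc)), ⟪θ i.castSucc k, b⟫_ℂ = 0 →
      σ ^ 2 / 2 * α θ i k ^ 2 * (((Gam θ i.castSucc)⁻¹ k k).re * ‖b‖ ^ 2 -
        ∑ l, ‖(Gam θ i.castSucc)⁻¹ l k‖ ^ 2 * ‖⟪w l, b⟫_ℂ‖ ^ 2 /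
          (η * ((Gam θ i.castSucc)⁻¹ l l).re)) ≤
        ∫ y, (⟪b, est y i.castSucc k⟫_ℂ).re ^ 2 ∂(law σ θ) := by
    intro b hb
    obtain ⟨v, hv, hen, hle⟩ := hA.exists_direction hΓA hw1 hη h k b
    have hv' : ∀ l, ⟪θ i.castSucc l, v l⟫_ℂ = 0 := by
      intro l
      have h1 := hv l
      simp only [hw, inner_smul_left, mul_eq_zero] at h1
      exact h1.resolve_left (by simpa using hT.ne')
    have hcr := hα.sq_mul_re_inner_le hσ hθ hest hcons i k hT hv' hb
    rw [hen] at hcr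
    set r := (⟪b, v k⟫_ℂ).re
    set I := ∫ y, (⟪b, est y i.castSucc k⟫_ℂ).re ^ 2 ∂(law σ θ)
    have hI : 0 ≤ I := integral_nonneg fun y => sq_nonneg _
    have hc : 0 ≤ σ ^ 2 / 2 * α θ i k ^ 2 := by positivity
    refine (mul_le_mul_of_nonneg_left hle hc).trans ?_
    -- Cancelling `r` needs `r > 0`; otherwise the lower bound is nonpositive and trivial.
    rcases le_or_gt r 0 with hr | hr
    · exact (mul_nonpos_of_nonneg_of_nonpos hc hr).trans hI
    · have h2 : (α θ i k ^ 2 * r) * r ≤ (I * (2 / σ ^ 2)) * r := by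
        calc _ = (α θ i k * r) ^ 2 := by ring
          _ ≤ _ := hcr
          _ = _ := by ring
      have h3 := le_of_mul_le_mul_right h2 hr
      calc σ ^ 2 / 2 * α θ i k ^ 2 * r = σ ^ 2 / 2 * (α θ i k ^ 2 * r) := by ring
        _ ≤ σ ^ 2 / 2 * (I * (2 / σ ^ 2)) := by gcongr
        _ = I := by field_simp
  have h1 := hreal a ha
  -- `Re⟪I • a, z⟫ = Im⟪a, z⟫`, while the lower bound depends on `a` only through norms.
  have h2 := hreal (Complex.I • a) (by rw [inner_smul_right, ha, mul_zero])
  simp only [inner_smul_right, norm_smul, norm_mul, Complex.norm_I, one_mul] at h2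
  have hint : ∀ b : EuclideanSpace ℂ (Fin (T i.castSucc)),
      Integrable (fun y => (⟪b, est y i.castSucc k⟫_ℂ).re ^ 2) (law σ θ) := by
    intro b
    refine .of_bound ((Complex.measurable_re.comp
      ((measurable_est hest _ _).const_inner)).pow_const 2).aestronglyMeasurable
        ((‖b‖ * √(T i.castSucc)) ^ 2) ?_
    filter_upwards [hcons.ae_norm i k] with y hy
    rw [← hy, norm_pow, Real.norm_eq_abs]
    gcongr
    exact (Complex.abs_re_le_norm _).trans (norm_inner_le_norm _ _)
  have hsum : ∫ y, ‖⟪a, est y i.castSucc k⟫_ℂ‖ ^ 2 ∂(law σ θ) =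
      (∫ y, (⟪a, est y i.castSucc k⟫_ℂ).re ^ 2 ∂(law σ θ)) +
        ∫ y, (⟪Complex.I • a, est y i.castSucc k⟫_ℂ).re ^ 2 ∂(law σ θ) := by
    rw [← integral_add (hint a) (hint _)]
    refine integral_congr_ae (Eventually.of_forall fun y => ?_)
    simp only [inner_smul_left, Complex.conj_I, ← Complex.normSq_eq_norm_sq, Complex.normSq_apply]
    simp
    ring
  rw [hsum]
  linarith

/-- The modified Cramér–Rao bound for an estimator with scalar bias. -/
theorem HasScalarBiasNear.sq_mul_one_add_xiStar_le {α : Param T K → Fin d → Fin K → ℝ}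
    (hα : HasScalarBiasNear σ θ est α) (hσ : 0 < σ)
    (hθ : ∀ (i : Fin d) (k : Fin K), ‖θ i.castSucc k‖ ^ 2 = (T i.castSucc : ℝ))
    (hest : Measurable est) (hcons : SatisfiesConstraints σ θ est) (i : Fin d) (k : Fin K)
    (hT : 1 < T i.castSucc) (hΓ : IsUnit (Gam θ i.castSucc)) {ηm ηp : ℝ} (hηm : 0 < ηm)
    (hm : ((Gam θ i.castSucc)⁻¹ - (ηm : ℂ) • diagInv θ i.castSucc).PosSemidef)
    (hp : ((ηp : ℂ) • diagInv θ i.castSucc - (Gam θ i.castSucc)⁻¹).PosSemidef) :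
    α θ i k ^ 2 * (1 + xiStar σ θ i.castSucc k ηm ηp) ≤ 1 := by
  have hT0 : 0 < T i.castSucc := by omega
  have hT' : (0 : ℝ) < T i.castSucc := by exact_mod_cast hT0
  have hT1 : (0 : ℝ) < (T i.castSucc : ℝ) - 1 := by
    have : (1 : ℝ) < T i.castSucc := by exact_mod_cast hT
    linarith
  have hA := Gam_inv_posDef hΓ
  set A := (Gam θ i.castSucc)⁻¹ with hAdef
  have hD := hA.diag_re_pos
  have hΓA : Gam θ i.castSucc * A = 1 :=
    mul_nonsing_inv _ ((isUnit_iff_isUnit_det _).1 hΓ)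
  have hηp : 1 ≤ ηp := hA.one_le_of_le_diagonal hp k
  have hres : (A k k).re * ‖residual θ i.castSucc k‖ ^ 2 = 1 := by
    have h1 := inv_gram_diag_mul_norm_sq_residual (Gam_apply θ i.castSucc) hΓA k
    have h2 := congrArg Complex.re h1
    rw [← Complex.ofReal_pow, Complex.re_mul_ofReal] at h2
    exact h2
  have hxk : θ i.castSucc k ≠ 0 := fun h0 => by
    have := hθ i k
    rw [h0, norm_zero] at this
    simp only [ne_eq, OfNat.ofNat_ne_zero, not_false_eq_true, zero_pow] at this
    linarith
  set V := (ℂ ∙ θ i.castSucc k)ᗮ with hV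
  have hfin : Module.finrank ℂ V = T i.castSucc - 1 := by
    have : Fact (Module.finrank ℂ (EuclideanSpace ℂ (Fin (T i.castSucc))) =
        (T i.castSucc - 1) + 1) := ⟨by rw [finrank_euclideanSpace_fin]; omega⟩
    exact Submodule.finrank_orthogonal_span_singleton hxk
  set b := stdOrthonormalBasis ℂ V with hb
  have hon : Orthonormal ℂ (fun j => (b j : EuclideanSpace ℂ (Fin (T i.castSucc)))) :=
    b.orthonormal.comp_linearIsometry V.subtypeₗᵢ
  have hbx : ∀ j, ⟪θ i.castSucc k, (b j : EuclideanSpace ℂ (Fin (T i.castSucc)))⟫_ℂ = 0 :=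
    fun j => Submodule.mem_orthogonal_singleton_iff_inner_right.1 (b j).2
  set w : Fin K → EuclideanSpace ℂ (Fin (T i.castSucc)) :=
    fun l => ((√(T i.castSucc))⁻¹ : ℂ) • θ i.castSucc l with hw
  have hw1 : ∀ l, ‖w l‖ = 1 := by
    intro l
    have h1 : ‖θ i.castSucc l‖ = √(T i.castSucc) := by
      rw [← hθ i l, Real.sqrt_sq (norm_nonneg _)]
    have h2 : √(T i.castSucc : ℝ) ≠ 0 := by positivity
    rw [hw, norm_smul, h1, norm_inv, Complex.norm_real, Real.norm_of_nonneg (Real.sqrt_nonneg _),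
      inv_mul_cancel₀ h2]
  have hcr : ∀ j, _ := fun j =>
    hα.le_integral_norm_inner_sq hσ hθ hest hcons i k hT0 hΓ hηm hm (hbx j)
  have hsum := Finset.sum_le_sum fun j (_ : j ∈ Finset.univ) => hcr j
  -- Bessel for `ẑ - αx`: subtracting `αx` changes no coefficient because each `b j` is orthogonal
  -- to `x`.
  have hupper : ∑ j, ∫ y, ‖⟪(b j : EuclideanSpace ℂ (Fin (T i.castSucc))),
      est y i.castSucc k⟫_ℂ‖ ^ 2 ∂(law σ θ) ≤ T i.castSucc * (1 - α θ i k ^ 2) := by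
    have h1 := hcons.integral_norm_sub_sq hσ hθ hest hα.bias_self i k (α θ i k)
    have h2 : (T i.castSucc : ℝ) * (1 - α θ i k ^ 2) =
        T i.castSucc * (1 - 2 * α θ i k * α θ i k + α θ i k ^ 2) := by ring
    have hmz : ∀ c : EuclideanSpace ℂ (Fin (T i.castSucc)),
        Integrable (fun y => ‖⟪c, est y i.castSucc k⟫_ℂ‖ ^ 2) (law σ θ) := by
      intro c
      refine .of_bound ((measurable_est hest _ _).const_inner.norm.pow_const 2).aestronglyMeasurable
        ((‖c‖ * √(T i.castSucc)) ^ 2) ?_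
      filter_upwards [hcons.ae_norm i k] with y hy
      rw [← hy, norm_pow, norm_norm]
      gcongr
      exact norm_inner_le_norm _ _
    rw [h2, ← h1, ← integral_finsetSum _ fun j _ => hmz _]
    refine integral_mono (integrable_finsetSum _ fun j _ => hmz _) ?_ fun y => ?_
    · have hm2 := ((measurable_est hest i.castSucc k).sub_const
        ((α θ i k : ℂ) • θ i.castSucc k)).norm.pow_const 2
      refine .of_bound hm2.aestronglyMeasurable
        ((√(T i.castSucc) + ‖(α θ i k : ℂ) • θ i.castSucc k‖) ^ 2) ?_
      filter_upwards [hcons.ae_norm i k] with y hy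
      rw [← hy, norm_pow, norm_norm]
      gcongr
      exact norm_sub_le _ _
    · have h3 := hon.sum_inner_products_le (s := Finset.univ)
        (x := est y i.castSucc k - (α θ i k : ℂ) • θ i.castSucc k)
      simpa only [inner_sub_right, inner_smul_right, inner_eq_zero_symm.1 (hbx _), mul_zero,
        sub_zero] using h3
  have hlower : σ ^ 2 * α θ i k ^ 2 * (A k k).re *
      (((T i.castSucc : ℝ) - 1) - (ηp ^ 2 - 1) / ηm) ≤
      T i.castSucc * (1 - α θ i k ^ 2) := by
    refine le_trans ?_ (hsum.trans hupper)
    rw [← Finset.mul_sum, mul_assoc (σ ^ 2 * α θ i k ^ 2)]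
    refine mul_le_mul_of_nonneg_left ?_ (by positivity)
    have hnorm : ∀ j, ‖(b j : EuclideanSpace ℂ (Fin (T i.castSucc)))‖ = 1 := fun j => hon.1 j
    have hcard : (Fintype.card (Fin (Module.finrank ℂ V)) : ℝ) = (T i.castSucc : ℝ) - 1 := by
      rw [Fintype.card_fin, hfin, Nat.cast_sub hT.le, Nat.cast_one]
    simp only [Finset.sum_sub_distrib, hnorm, one_pow, mul_one, Finset.sum_const,
      Finset.card_univ, nsmul_eq_mul, hcard]
    have hbessel : ∑ j, ∑ l, ‖A l k‖ ^ 2 *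
        ‖⟪w l, (b j : EuclideanSpace ℂ (Fin (T i.castSucc)))⟫_ℂ‖ ^ 2 / (ηm * (A l l).re) ≤
        ((A k k).re * (ηp ^ 2 - 1)) / ηm := by
      rw [Finset.sum_comm]
      -- The term `l = k` vanishes since `b j ⟂ x_k`; this is what allows `A_kk` to be subtracted.
      -- The other terms use Bessel for the unit vectors `w l`.
      have h1 : ∀ l, ∑ j, ‖A l k‖ ^ 2 *
          ‖⟪w l, (b j : EuclideanSpace ℂ (Fin (T i.castSucc)))⟫_ℂ‖ ^ 2 / (ηm * (A l l).re) ≤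
          (‖A l k‖ ^ 2 / (A l l).re - if l = k then (A k k).re else 0) / ηm := by
        intro l
        have hDl := hD l
        by_cases hl : l = k
        · subst hl
          have h2 : ∀ j, ⟪w l, (b j : EuclideanSpace ℂ (Fin (T i.castSucc)))⟫_ℂ = 0 := fun j => by
            rw [hw, inner_smul_left, hbx, mul_zero]
          have h3 : (A l l).re ≤ ‖A l l‖ := Complex.re_le_norm _
          simp only [h2, norm_zero, ne_eq, OfNat.ofNat_ne_zero, not_false_eq_true, zero_pow,
            mul_zero, zero_div, Finset.sum_const_zero, if_true]
          refine div_nonneg ?_ hηm.le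
          rw [sub_nonneg, le_div_iff₀ hDl, sq]
          gcongr
        · rw [if_neg hl, sub_zero, ← Finset.sum_div, ← Finset.mul_sum, div_div, mul_comm ηm]
          have h2 : ∑ j, ‖⟪w l, (b j : EuclideanSpace ℂ (Fin (T i.castSucc)))⟫_ℂ‖ ^ 2 ≤ 1 := by
            have := hon.sum_inner_products_le (s := Finset.univ) (x := w l)
            rw [hw1, one_pow] at this
            refine le_of_eq_of_le (Finset.sum_congr rfl fun j _ => ?_) this
            rw [norm_inner_symm]
          refine div_le_div_of_nonneg_right ?_ (by positivity)
          exact mul_le_of_le_one_right (sq_nonneg _) h2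
      refine (Finset.sum_le_sum fun l _ => h1 l).trans ?_
      rw [← Finset.sum_div, Finset.sum_sub_distrib, Finset.sum_ite_eq' Finset.univ k,
        if_pos (Finset.mem_univ k)]
      refine div_le_div_of_nonneg_right ?_ hηm.le
      -- This yields the factor `η⁺ - 1`, weakened to `(η⁺)² - 1` using `η⁺ ≥ 1`.
      have h2 := hA.sum_sq_col_div_diag_le (by linarith) hp k
      nlinarith [hD k, mul_nonneg (hD k).le (mul_nonneg (by linarith : (0 : ℝ) ≤ ηp)
        (by linarith : (0 : ℝ) ≤ ηp - 1))]
    have : (A k k).re * (((T i.castSucc : ℝ) - 1) - (ηp ^ 2 - 1) / ηm) =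
        ((T i.castSucc : ℝ) - 1) * (A k k).re - ((A k k).re * (ηp ^ 2 - 1)) / ηm := by ring
    rw [this]
    exact sub_le_sub_left hbessel _
  have hxi : (T i.castSucc : ℝ) * xiStar σ θ i.castSucc k ηm ηp =
      σ ^ 2 * (A k k).re * (((T i.castSucc : ℝ) - 1) - (ηp ^ 2 - 1) / ηm) := by
    have hr : ‖residual θ i.castSucc k‖ ^ 2 = ((A k k).re)⁻¹ := eq_inv_of_mul_eq_one_right hres
    have := (hD k).ne'
    rw [xiStar, hr]
    field_simp
  have h5 : (T i.castSucc : ℝ) * (α θ i k ^ 2 * (1 + xiStar σ θ i.castSucc k ηm ηp)) ≤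
      T i.castSucc * 1 := by
    have : (T i.castSucc : ℝ) * (α θ i k ^ 2 * (1 + xiStar σ θ i.castSucc k ηm ηp)) =
        T i.castSucc * α θ i k ^ 2 +
          α θ i k ^ 2 * ((T i.castSucc : ℝ) * xiStar σ θ i.castSucc k ηm ηp) := by ring
    rw [this, hxi]
    linarith
  exact le_of_mul_le_mul_left h5 hT'

end TensorMod

/-! ### Both claims from the second-moment identity and the modified bound. -/

theorem lemma1 {d K : ℕ} {T : Fin (d + 1) → ℕ} (hT : ∀ i : Fin d, 1 < T i.castSucc)
    (σ : ℝ) (hσ : 0 < σ)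
    (θ : TensorMod.Param T K)
    (hθ : ∀ (i : Fin d) (k : Fin K), ‖θ i.castSucc k‖ ^ 2 = (T i.castSucc : ℝ))
    (est : TensorMod.Obs T → TensorMod.Param T K) (hest : Measurable est)
    (hcons : TensorMod.SatisfiesConstraints σ θ est) :
    (∀ α : Fin d → Fin K → ℝ, TensorMod.HasScalarBias σ θ est α →
      ∀ (i : Fin d) (k : Fin K), α i k ≠ 0 →
        α i k ^ 2 = 1 / (1 + TensorMod.normVar σ θ est α i k)) ∧
    (∀ α : TensorMod.Param T K → Fin d → Fin K → ℝ, TensorMod.HasScalarBiasNear σ θ est α →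
      ∀ i : Fin d, IsUnit (TensorMod.Gam θ i.castSucc) →
      ∀ ηm ηp : ℝ, 0 < ηm → ηm ≤ ηp →
        ((TensorMod.Gam θ i.castSucc)⁻¹
          - (ηm : ℂ) • TensorMod.diagInv θ i.castSucc).PosSemidef →
        ((ηp : ℂ) • TensorMod.diagInv θ i.castSucc
          - (TensorMod.Gam θ i.castSucc)⁻¹).PosSemidef →
      ∀ k : Fin K, 0 < 1 + TensorMod.xiStar σ θ i.castSucc k ηm ηp →
        TensorMod.mse σ θ est i k
          ≥ 2 * (1 - 1 / Real.sqrt (1 + TensorMod.xiStar σ θ i.castSucc k ηm ηp))) := by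
  refine ⟨fun α hα i k hne => ?_, fun α hα i hΓ ηm ηp hηm _ hm hp k hpos => ?_⟩
  · have hT' : (T i.castSucc : ℝ) ≠ 0 := by exact_mod_cast (by have := hT i; omega)
    -- With `β = α` the variance is `T(1 - α²)`, hence `ξ = (1 - α²) / α²`.
    rw [TensorMod.normVar, hcons.integral_norm_sub_sq hσ hθ hest hα]
    field_simp
    ring
  · have hT' : (T i.castSucc : ℝ) ≠ 0 := by exact_mod_cast (by have := hT i; omega)
    have hmse : TensorMod.mse σ θ est i k = 2 * (1 - α θ i k) := by
      have h1 := hcons.integral_norm_sub_sq hσ hθ hest hα.bias_self i k 1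
      simp only [Complex.ofReal_one, one_smul] at h1
      rw [TensorMod.mse, h1]
      field_simp
      ring
    have hle := hα.sq_mul_one_add_xiStar_le hσ hθ hest hcons i k (hT i) hΓ hηm hm hp
    -- The mean square error decreases in `α`, so the upper bound on `α` is the lower bound sought.
    have hα1 : α θ i k ≤ 1 / √(1 + TensorMod.xiStar σ θ i.castSucc k ηm ηp) := by
      rw [le_div_iff₀ (Real.sqrt_pos.2 hpos)]
      refine le_of_sq_le_sq ?_ zero_le_one
      rwa [mul_pow, Real.sq_sqrt hpos.le, one_pow]
    rw [hmse]
    linarith
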